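/- Let $k$ be a positive integer and let $\mathcal{H}_k$ be the set of labelled graphs on the vertex set $[k]$. A rule of order $k$ is a matrix $\mathcal{R}=(\mathcal{R}_{F,H})_{F,H\in\mathcal{H}_k}$ with entries in $[0,1]$ such that $\sum_{H}\mathcal{R}_{F,H}=1$ for every $F\in\mathcal{H}_k$. A $2$-rooted graph $F^{a,b}$ of order $k$ consists of a graph $F\in\mathcal{H}_k$ and an ordered pair $(a,b)$ of distinct vertices in $[k]$; write $\mathcal{G}_k$ for the set of all of them. Two $2$-rooted graphs $F^{a,b}$ and $G^{c,d}$ are isomorphic if there is a graph isomorphism from $F$ to $G$ that maps $a$ to $c$ and $b$ to $d$; write $\mathcal{J}_k$ for the set of isomorphism classes of $\mathcal{G}_k$. For $F^{a,b}\in\mathcal{G}_k$ and $J\in\mathcal{J}_k$ put $$Z_{F^{a,b},\mathcal{R}}=\sum_{H\in\mathcal{H}_k}\mathcal{R}_{F,H}\cdot\mathbf{1}[ab\in E(H)]-\mathbf{1}[ab\in E(F)],\qquad a_{J,\mathcal{R}}=\sum_{F^{a,b}\in J}Z_{F^{a,b},\mathcal{R}}.$$ Let $(\Omega,\pi)$ be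 an atomless probability space. A kernel is a symmetric element of $L^\infty(\Omega^2)$, and a graphon is a kernel with values in $[0,1]$; write $\mathcal{W}$ for the space of kernels, equipped with the norm $\|\cdot\|_\infty$, and $\mathcal{W}_0$ for the set of graphons. For $W\in\mathcal{W}$ and $F^{a,b}\in\mathcal{G}_k$ define $t_{F^{a,b}}W\in L^\infty(\Omega^2)$ by $$t_{F^{a,b}}W(x,y)=\int\prod_{ij\in E(F)}W(x_i,x_j)\prod_{ij\notin E(F)}\bigl(1-W(x_i,x_j)\bigr)\,\mathrm{d}\pi^{[k]\setminus\{a,b\}},$$ where the products are over unordered pairs of distinct vertices, $x_a=x$ and $x_b=y$ are fixed, and the integral is over $(x_i)_{i\in[k]\setminus\{a,b\}}$. The velocity operator $\mathfrak{V}_{\mathcal{R}}\colon\mathcal{W}\to\mathcal{W}$ of a rule $\mathcal{R}$ of order $k$ is $$\mathfrak{V}_{\mathcal{R}}W=\sum_{F^{a,b}\in\mathcal{G}_k}Z_{F^{a,b},\mathcal{R}}\cdot t_{F^{a,b}}W.$$ A trajectory of $\mathcal{R}$ starting at $W\in\mathcal{W}$ is a differentiable function $\gamma\colon I\to(\mathcal{W},\|\cdot\|_\infty)$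 on an open interval $I\ni 0$ with $\gamma(0)=W$ and $\gamma'(t)=\mathfrak{V}_{\mathcal{R}}(\gamma(t))$ for all $t\in I$. The maximal trajectory of $\mathcal{R}$ starting at $W$ is the trajectory of which every trajectory of $\mathcal{R}$ starting at $W$ is a restriction to a subinterval. Two rules $\mathcal{R}_1,\mathcal{R}_2$ have the same trajectories if, for every $W\in\mathcal{W}$, their maximal trajectories starting at $W$ exist, have the same domain, and take the same values on it. Theorem. Let $\mathcal{R}_1$ and $\mathcal{R}_2$ be rules of the same order $k$. The following are equivalent. (S1) $a_{J,\mathcal{R}_1}=a_{J,\mathcal{R}_2}$ for all $J\in\mathcal{J}_k$. (S2) $\mathfrak{V}_{\mathcal{R}_1}W=\mathfrak{V}_{\mathcal{R}_2}W$ for all graphons $W\in\mathcal{W}_0$. (S3) $\mathfrak{V}_{\mathcal{R}_1}W=\mathfrak{V}_{\mathcal{R}_2}W$ for all kernels $W\in\mathcal{W}$. (S4) $\mathcal{R}_1$ and $\mathcal{R}_2$ have the same trajectories. -/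

import Mathlib

open MeasureTheory
open scoped ENNReal

noncomputable section

namespace FlipProcess

/-- A flip-process rule of order `k`: a row-stochastic matrix with entries in `[0,1]`, indexed by
the labelled graphs on a vertex set with `k` elements. -/
structure Rule (k : ℕ) where
  prob : SimpleGraph (Fin k) → SimpleGraph (Fin k) → ℝ
  prob_mem : ∀ F H, prob F H ∈ Set.Icc (0 : ℝ) 1
  sum_prob : ∀ F, ∑ H, prob F H = 1

/-- The 2-rooted labelled graphs `F^{a,b}` of order `k`: a labelled graph `F` together with an
ordered pair `(a, b)` of distinct vertices. -/
abbrev RootedGraph (k : ℕ) : Type :=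
  SimpleGraph (Fin k) × {p : Fin k × Fin k // p.1 ≠ p.2}

namespace RootedGraph

variable {k : ℕ}

/-- The underlying labelled graph `F` of `F^{a,b}`. -/
abbrev graph (G : RootedGraph k) : SimpleGraph (Fin k) := G.1

/-- The first root `a` of `F^{a,b}`. -/
abbrev fst (G : RootedGraph k) : Fin k := G.2.1.1

/-- The second root `b` of `F^{a,b}`. -/
abbrev snd (G : RootedGraph k) : Fin k := G.2.1.2

/-- Isomorphism of rooted graphs: a graph isomorphism that maps roots to roots and preserves their
order, that is, one that maps the first root to the first root and the second to the second. -/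
def Iso (G H : RootedGraph k) : Prop :=
  ∃ φ : G.graph ≃g H.graph, φ G.fst = H.fst ∧ φ G.snd = H.snd

/-- The isomorphism relation on rooted graphs of order `k`. -/
instance isoSetoid (k : ℕ) : Setoid (RootedGraph k) where
  r := Iso
  iseqv :=
    { refl := fun G => ⟨SimpleGraph.Iso.refl, rfl, rfl⟩
      symm := by
        rintro G H ⟨φ, h1, h2⟩
        exact ⟨φ.symm, by rw [← h1]; exact φ.symm_apply_apply _,
          by rw [← h2]; exact φ.symm_apply_apply _⟩
      trans := by
        rintro G H K ⟨φ, h1, h2⟩ ⟨ψ, h3, h4⟩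
        exact ⟨φ.trans ψ, by rw [← h3, ← h1]; rfl, by rw [← h4, ← h2]; rfl⟩ }

end RootedGraph

/-- The isomorphism classes `J` of 2-rooted labelled graphs of order `k`. -/
abbrev RootedClass (k : ℕ) : Type := Quotient (RootedGraph.isoSetoid k)

open scoped Classical in
/-- The coefficient `∑_H R_{F,H} 1[ab ∈ E(H)] - 1[ab ∈ E(F)]` of a rooted graph `F^{a,b}`. -/
def Rule.coeff {k : ℕ} (R : Rule k) (G : RootedGraph k) : ℝ :=
  (∑ H : SimpleGraph (Fin k), R.prob G.graph H * (if H.Adj G.fst G.snd then 1 else 0))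
    - (if G.graph.Adj G.fst G.snd then 1 else 0)

open scoped Classical in
/-- The orbit coefficient `a_{J,R}`: the sum of the coefficients of all `F^{a,b} ∈ J`. -/
def Rule.orbitCoeff {k : ℕ} (R : Rule k) (J : RootedClass k) : ℝ :=
  ∑ G : RootedGraph k with (⟦G⟧ : RootedClass k) = J, R.coeff G

/-- A measure is atomless if every measurable set of positive measure has a measurable subset of
strictly smaller positive measure. -/
def IsAtomless {Ω : Type*} [MeasurableSpace Ω] (π : Measure Ω) : Prop :=
  ∀ s, MeasurableSet s → 0 < π s → ∃ t ⊆ s, MeasurableSet t ∧ 0 < π t ∧ π t < π s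

variable {Ω : Type*} [MeasurableSpace Ω]

/-- The space of kernels: the symmetric elements of `L^∞(Ω²)`, with the essential supremum norm. -/
def kernelSpace (π : Measure Ω) [IsProbabilityMeasure π] :
    Submodule ℝ (Lp ℝ ∞ (π.prod π)) where
  carrier := {W | ∀ᵐ p ∂(π.prod π), W p.swap = W p}
  add_mem' := by
    intro U W hU hW
    have h := Lp.coeFn_add U W
    have h' := (Measure.measurePreserving_swap (μ := π) (ν := π)).quasiMeasurePreserving.ae h
    filter_upwards [hU, hW, h, h'] with p h1 h2 h3 h4
    rw [h3, h4]
    simp only [Pi.add_apply, h1, h2]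
  zero_mem' := by
    have h := Lp.coeFn_zero ℝ ∞ (π.prod π)
    have h' := (Measure.measurePreserving_swap (μ := π) (ν := π)).quasiMeasurePreserving.ae h
    filter_upwards [h, h'] with p h3 h4
    rw [h3, h4]
    simp
  smul_mem' := by
    intro c W hW
    have h := Lp.coeFn_smul c W
    have h' := (Measure.measurePreserving_swap (μ := π) (ν := π)).quasiMeasurePreserving.ae h
    filter_upwards [hW, h, h'] with p h1 h3 h4
    rw [h3, h4]
    simp only [Pi.smul_apply, h1]

/-- A graphon is a kernel with values in `[0,1]` (almost everywhere). -/
def IsGraphon {π : Measure Ω} [IsProbabilityMeasure π] (W : kernelSpace π) : Prop :=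
  ∀ᵐ p ∂(π.prod π), (W : Lp ℝ ∞ (π.prod π)) p ∈ Set.Icc (0 : ℝ) 1

/-- The point `(x_i)_i` of `Ω^k` with `x_a = x`, `x_b = y` and the remaining coordinates, those of
the non-root vertices, given by `z`. -/
def assign {k : ℕ} (a b : Fin k) (p : Ω × Ω) (z : ↥({a, b}ᶜ : Finset (Fin k)) → Ω)
    (i : Fin k) : Ω :=
  if ha : i = a then p.1 else if hb : i = b then p.2 else z ⟨i, by simp [ha, hb]⟩

open scoped Classical in
/-- The product `∏_{ij ∈ E(F)} W(x_i,x_j) ∏_{ij ∉ E(F)} (1 - W(x_i,x_j))`, in which each unordered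
pair of distinct vertices occurs once. -/
def inducedProd {k : ℕ} (F : SimpleGraph (Fin k)) (W : Ω × Ω → ℝ) (x : Fin k → Ω) : ℝ :=
  ∏ i : Fin k, ∏ j ∈ Finset.Ioi i, if F.Adj i j then W (x i, x j) else 1 - W (x i, x j)

/-- The rooted induced density `t_{F^{a,b}} W(x,y)` of a function `W` on `Ω²`: the integral of the
product over the coordinates of the non-root vertices. -/
def densityFun {k : ℕ} (π : Measure Ω) (G : RootedGraph k) (W : Ω × Ω → ℝ) (p : Ω × Ω) : ℝ :=
  ∫ z : ↥({G.fst, G.snd}ᶜ : Finset (Fin k)) → Ω,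
    inducedProd G.graph W (assign G.fst G.snd p z) ∂(Measure.pi fun _ => π)

/-! ### The rooted induced density is a well-defined element of `L^∞(Ω²)` -/

lemma measurable_assign {k : ℕ} (a b : Fin k) :
    Measurable (fun q : (Ω × Ω) × (↥({a, b}ᶜ : Finset (Fin k)) → Ω) =>
      assign a b q.1 q.2) := by
  refine measurable_pi_iff.2 fun i => ?_
  unfold assign
  split_ifs <;> fun_prop

lemma measurePreserving_assign {k : ℕ} (π : Measure Ω) [IsProbabilityMeasure π] {a b : Fin k}
    (hab : a ≠ b) :
    MeasurePreserving (fun q : (Ω × Ω) × (↥({a, b}ᶜ : Finset (Fin k)) → Ω) =>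
      assign a b q.1 q.2) ((π.prod π).prod (Measure.pi fun _ => π)) (Measure.pi fun _ => π) := by
  refine ⟨measurable_assign a b, (Measure.pi_eq fun s hs => ?_).symm⟩
  rw [Measure.map_apply (measurable_assign a b) (MeasurableSet.univ_pi hs)]
  have hpre : (fun q : (Ω × Ω) × (↥({a, b}ᶜ : Finset (Fin k)) → Ω) =>
      assign a b q.1 q.2) ⁻¹' (Set.univ.pi s)
      = (s a ×ˢ s b) ×ˢ (Set.univ.pi fun i => s i.1) := by
    ext q
    simp only [Set.mem_preimage, Set.mem_pi, Set.mem_univ, true_implies, Set.mem_prod]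
    constructor
    · intro h
      refine ⟨⟨by simpa [assign] using h a, by simpa [assign, hab.symm] using h b⟩, ?_⟩
      rintro ⟨i, hi⟩
      have hi' : i ≠ a ∧ i ≠ b := by simpa using hi
      simpa [assign, hi'.1, hi'.2] using h i
    · rintro ⟨⟨h1, h2⟩, h3⟩ i
      unfold assign
      split_ifs with ha hb
      · rwa [ha]
      · rwa [hb]
      · exact h3 ⟨i, by simp [ha, hb]⟩
  rw [hpre, Measure.prod_prod, Measure.prod_prod, Measure.pi_pi,
    ← Finset.prod_mul_prod_compl ({a, b} : Finset (Fin k)), Finset.prod_pair hab,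
    Finset.prod_coe_sort ({a, b}ᶜ : Finset (Fin k)) fun i => π (s i)]

lemma measurePreserving_pair {k : ℕ} (π : Measure Ω) [IsProbabilityMeasure π] {i j : Fin k}
    (hij : i ≠ j) :
    MeasurePreserving (fun x : Fin k → Ω => (x i, x j)) (Measure.pi fun _ => π) (π.prod π) := by
  have hm : Measurable (fun x : Fin k → Ω => (x i, x j)) := by fun_prop
  refine ⟨hm, (Measure.prod_eq fun s t hs ht => ?_).symm⟩
  rw [Measure.map_apply hm (hs.prod ht)]
  have hpre : (fun x : Fin k → Ω => (x i, x j)) ⁻¹' (s ×ˢ t)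
      = (({i, j} : Finset (Fin k)) : Set (Fin k)).pi fun l => if l = i then s else t := by
    ext x
    simp [hij.symm]
  rw [hpre, Measure.pi_pi_finset, Finset.prod_pair hij]
  simp [hij.symm]

lemma measurable_inducedProd {k : ℕ} (F : SimpleGraph (Fin k)) {W : Ω × Ω → ℝ}
    (hW : Measurable W) : Measurable (inducedProd F W) := by
  unfold inducedProd
  refine Finset.measurable_prod _ fun i _ => Finset.measurable_prod _ fun j _ => ?_
  split_ifs <;> fun_prop

lemma memLp_densityFun {k : ℕ} {π : Measure Ω} [IsProbabilityMeasure π] (G : RootedGraph k)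
    (W : Lp ℝ ∞ (π.prod π)) : MemLp (densityFun π G W) ∞ (π.prod π) := by
  obtain ⟨C, hC⟩ : ∃ C : ℝ, ∀ᵐ p ∂(π.prod π), ‖W p‖ ≤ C :=
    ⟨_, ae_le_lpNorm_exponent_top (Lp.memLp W)⟩
  have hWm : Measurable W := (Lp.stronglyMeasurable W).measurable
  have hmeas : StronglyMeasurable (densityFun π G W) :=
    StronglyMeasurable.integral_prod_right'
      (f := fun q : (Ω × Ω) × (↥({G.fst, G.snd}ᶜ : Finset (Fin k)) → Ω) =>
        inducedProd G.graph W (assign G.fst G.snd q.1 q.2))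
      ((measurable_inducedProd _ hWm).comp (measurable_assign _ _)).stronglyMeasurable
  have hpairs : ∀ᵐ x ∂(Measure.pi fun _ : Fin k => π),
      ∀ i j : Fin k, i ≠ j → ‖W (x i, x j)‖ ≤ C := by
    refine ae_all_iff.2 fun i => ae_all_iff.2 fun j => ?_
    by_cases hij : i = j
    · simp [hij]
    · filter_upwards [(measurePreserving_pair π hij).quasiMeasurePreserving.ae hC] with x hx _
      exact hx
  have hprod : ∀ᵐ x ∂(Measure.pi fun _ : Fin k => π),
      ‖inducedProd G.graph W x‖ ≤ ∏ i : Fin k, ∏ _j ∈ Finset.Ioi i, (1 + C) := by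
    filter_upwards [hpairs] with x hx
    unfold inducedProd
    rw [norm_prod]
    refine Finset.prod_le_prod (fun _ _ => norm_nonneg _) fun i _ => ?_
    rw [norm_prod]
    refine Finset.prod_le_prod (fun _ _ => norm_nonneg _) fun j hj => ?_
    have h := hx i j (Finset.mem_Ioi.1 hj).ne
    split_ifs
    · linarith
    · exact (norm_sub_le _ _).trans (by rw [norm_one]; linarith)
  refine memLp_top_of_bound hmeas.aestronglyMeasurable
    (∏ i : Fin k, ∏ _j ∈ Finset.Ioi i, (1 + C)) ?_
  have h := Measure.ae_ae_of_ae_prod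
    ((measurePreserving_assign π G.2.2).quasiMeasurePreserving.ae hprod)
  filter_upwards [h] with p hp
  simpa [densityFun] using norm_integral_le_of_norm_le_const hp

/-- The operator `t_{F^{a,b}}` from kernels to `L^∞(Ω²)`. -/
def rootedDensity {k : ℕ} {π : Measure Ω} [IsProbabilityMeasure π] (G : RootedGraph k)
    (W : kernelSpace π) : Lp ℝ ∞ (π.prod π) :=
  (memLp_densityFun G (W : Lp ℝ ∞ (π.prod π))).toLp _

/-- The rooted graph `F^{b,a}`. -/
def RootedGraph.swap {k : ℕ} (G : RootedGraph k) : RootedGraph k :=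
  (G.graph, ⟨(G.snd, G.fst), G.2.2.symm⟩)

lemma densityFun_swap {k : ℕ} (π : Measure Ω) (G : RootedGraph k) (W : Ω × Ω → ℝ) (p : Ω × Ω) :
    densityFun π G.swap W p.swap = densityFun π G W p := by
  obtain ⟨F, ⟨⟨a, b⟩, hab⟩⟩ := G
  have key : ∀ (S T : Finset (Fin k)) (hS : ∀ i, i ≠ b → i ≠ a → i ∈ S)
      (hT : ∀ i, i ≠ a → i ≠ b → i ∈ T), S = T →
      ∫ z : ↥S → Ω, inducedProd F W (fun i => if hb : i = b then p.2 else
        if ha : i = a then p.1 else z ⟨i, hS i hb ha⟩) ∂(Measure.pi fun _ => π)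
      = ∫ z : ↥T → Ω, inducedProd F W (fun i => if ha : i = a then p.1 else
        if hb : i = b then p.2 else z ⟨i, hT i ha hb⟩) ∂(Measure.pi fun _ => π) := by
    rintro S T hS hT rfl
    congr 1
    funext z
    congr 1
    funext i
    split_ifs with h1 h2
    · exact absurd (h2.symm.trans h1) hab
    all_goals rfl
  exact key ({b, a}ᶜ) ({a, b}ᶜ) (fun i h1 h2 => by simp [h1, h2]) (fun i h1 h2 => by simp [h1, h2])
    (by rw [Finset.pair_comm])

open scoped Classical in
lemma coeff_swap {k : ℕ} (R : Rule k) (G : RootedGraph k) : R.coeff G.swap = R.coeff G := by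
  have h : ∀ H : SimpleGraph (Fin k), H.Adj G.2.1.2 G.2.1.1 ↔ H.Adj G.2.1.1 G.2.1.2 :=
    fun H => H.adj_comm _ _
  unfold Rule.coeff
  congr 1
  · exact Finset.sum_congr rfl fun H _ => congrArg _ (if_congr (h H) rfl rfl)
  · exact if_congr (h _) rfl rfl

/-- The velocity `∑_{F^{a,b}} t_{F^{a,b}} W · (∑_H R_{F,H} 1[ab ∈ E(H)] - 1[ab ∈ E(F)])` of a
kernel is symmetric. -/
lemma sum_mem_kernelSpace {k : ℕ} {π : Measure Ω} [IsProbabilityMeasure π] (R : Rule k)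
    (W : kernelSpace π) :
    ∑ G : RootedGraph k, R.coeff G • rootedDensity G W ∈ kernelSpace π := by
  have h : ∀ᵐ p ∂(π.prod π), (∑ G : RootedGraph k, R.coeff G • rootedDensity G W :
      Lp ℝ ∞ (π.prod π)) p
      = ∑ G : RootedGraph k, R.coeff G * densityFun π G (W : Lp ℝ ∞ (π.prod π)) p := by
    have h1 : ∀ᵐ p ∂(π.prod π), ∀ G : RootedGraph k, (R.coeff G • rootedDensity G W) p
        = R.coeff G * densityFun π G (W : Lp ℝ ∞ (π.prod π)) p := by
      refine ae_all_iff.2 fun G => ?_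
      filter_upwards [Lp.coeFn_smul (R.coeff G) (rootedDensity G W),
        (memLp_densityFun G (W : Lp ℝ ∞ (π.prod π))).coeFn_toLp] with p h2 h3
      rw [h2, Pi.smul_apply, smul_eq_mul, rootedDensity, h3]
    filter_upwards [Lp.coeFn_finsetSum Finset.univ
      fun G : RootedGraph k => R.coeff G • rootedDensity G W, h1] with p h2 h3
    rw [h2, Finset.sum_apply]
    exact Finset.sum_congr rfl fun G _ => h3 G
  have h' := (Measure.measurePreserving_swap (μ := π) (ν := π)).quasiMeasurePreserving.ae h
  change ∀ᵐ p ∂(π.prod π), _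
  filter_upwards [h, h'] with p h1 h2
  rw [h1, h2]
  refine Finset.sum_bij (fun G _ => G.swap) (fun _ _ => Finset.mem_univ _) ?_ ?_ ?_
  · intro G _ H _ hGH
    exact congrArg RootedGraph.swap hGH
  · intro G _
    exact ⟨G.swap, Finset.mem_univ _, rfl⟩
  · intro G _
    rw [coeff_swap, ← densityFun_swap π G.swap]
    rfl

/-- The velocity operator of a rule on the space of kernels. -/
def velocity {k : ℕ} {π : Measure Ω} [IsProbabilityMeasure π] (R : Rule k) (W : kernelSpace π) :
    kernelSpace π :=
  ⟨∑ G : RootedGraph k, R.coeff G • rootedDensity G W, sum_mem_kernelSpace R W⟩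

/-- `γ`, restricted to the open interval `I ∋ 0`, is a trajectory of the rule `R` starting at the
kernel `W`: it is differentiable with respect to the essential supremum norm and solves
`d/dt γ(t) = velocity R (γ(t))` on `I`, with `γ(0) = W`. The values of `γ` outside `I` are
irrelevant. -/
structure IsTrajectory {k : ℕ} {π : Measure Ω} [IsProbabilityMeasure π] (R : Rule k)
    (W : kernelSpace π) (I : Set ℝ) (γ : ℝ → kernelSpace π) : Prop where
  isOpen : IsOpen I
  ordConnected : I.OrdConnected
  zero_mem : (0 : ℝ) ∈ I
  initial : γ 0 = W
  hasDerivAt : ∀ t ∈ I, HasDerivAt γ (velocity R (γ t)) t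

/-- `γ` on `I` is the maximal trajectory of `R` starting at `W`: every trajectory of `R` starting at
`W` is a restriction of it to a subinterval of `I`. -/
structure IsMaximalTrajectory {k : ℕ} {π : Measure Ω} [IsProbabilityMeasure π] (R : Rule k)
    (W : kernelSpace π) (I : Set ℝ) (γ : ℝ → kernelSpace π) : Prop where
  isTrajectory : IsTrajectory R W I γ
  maximal : ∀ I' γ', IsTrajectory R W I' γ' → I' ⊆ I ∧ Set.EqOn γ' γ I'

/-- Two rules have the same trajectories: for every kernel `W`, the maximal trajectories of the two
rules starting at `W` exist, have the same domain, and take the same values on it. -/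
def SameTrajectories {k : ℕ} (π : Measure Ω) [IsProbabilityMeasure π] (R₁ R₂ : Rule k) : Prop :=
  ∀ W : kernelSpace π, ∃ (I₁ I₂ : Set ℝ) (γ₁ γ₂ : ℝ → kernelSpace π),
    IsMaximalTrajectory R₁ W I₁ γ₁ ∧ IsMaximalTrajectory R₂ W I₂ γ₂ ∧
      I₁ = I₂ ∧ ∀ t ∈ I₁, γ₁ t = γ₂ t

end FlipProcess

end

/-! The velocity is a finite linear combination of rooted densities. Relabelling the non-root
vertices does not change the integral, so the density of a rooted graph depends only on its
isomorphism class. Grouping by class (`velocity_eq_sum_orbitCoeff`) shows that the orbit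
coefficients determine the velocity on all kernels.

Conversely, the velocities at step graphons recover the orbit coefficients. Fix a rooted graph `H`,
split Ω into parts labelled by its vertices with weights `α i`, and take the 0/1 step graphon of
`H`. Integrated over the product of the two root parts, the velocity becomes a polynomial in `α`, a
sum over maps `φ` of the vertex set into itself (`integral_indicator_mul_velocity`). If the two
rules agree at every such graphon, the difference of their polynomials vanishes for all positive
`α`, hence so does its coefficient at the monomial in which every variable occurs once. Only
bijective `φ` contribute to that coefficient, and for each rule they count isomorphisms: its value
is the number of automorphisms of `H` times the orbit coefficient of its class. Atomlessness enters
only to realise arbitrary weights (`IsAtomless.exists_measurable_label`).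

For trajectories, the velocity is Lipschitz on balls of a Banach space
(`exists_lipschitzOnWith_velocity`), so maximal trajectories exist and are the same for equal
velocities. In the other direction, the velocity at `W` is the derivative at time 0 of the
trajectory from `W`. -/

namespace FlipProcess

/-! ### Autonomous equations with a vector field that is Lipschitz on balls -/

section ODE

variable {E : Type*} [NormedAddCommGroup E] [NormedSpace ℝ E] {v : E → E}

open Set Metric in
/-- Local existence for an autonomous equation whose vector field is Lipschitz on balls. -/
lemma exists_hasDerivAt_Ioo_of_lipschitzOnWith_closedBall [CompleteSpace E]
    (hv : ∀ C : ℝ, ∃ K, LipschitzOnWith K v (closedBall 0 C)) (x : E) :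
    ∃ ε > (0 : ℝ), ∃ α : ℝ → E, α 0 = x ∧ ∀ t ∈ Ioo (-ε) ε, HasDerivAt α (v (α t)) t := by
  obtain ⟨K, hK⟩ := hv (‖x‖ + 1)
  have hsub : closedBall x 1 ⊆ closedBall 0 (‖x‖ + 1) :=
    closedBall_subset_closedBall' (by rw [dist_zero_right]; linarith)
  have hK' := hK.mono hsub
  set L : NNReal := ‖v x‖₊ + K with hL
  -- At speed at most `L`, a solution stays in the unit ball around `x` for any time `ε` with `L * ε
  -- ≤ 1`; the `+ 1` keeps the quotient meaningful when `L = 0`.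
  have hε : (0 : ℝ) < 1 / (L + 1) := by positivity
  have hb : ∀ y ∈ closedBall x ((1 : NNReal) : ℝ), ‖v y‖ ≤ L := by
    intro y hy
    have h1 : ‖v y - v x‖ ≤ K * ‖y - x‖ := by
      simpa [dist_eq_norm] using hK'.dist_le_mul y hy x (mem_closedBall_self zero_le_one)
    have h2 : ‖y - x‖ ≤ 1 := by simpa [dist_eq_norm] using hy
    have h3 : ‖v y‖ ≤ ‖v x‖ + ‖v y - v x‖ := by
      simpa using norm_add_le (v x) (v y - v x)
    have h4 : (K : ℝ) * ‖y - x‖ ≤ K := mul_le_of_le_one_right K.2 h2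
    rw [hL]
    push_cast
    linarith
  have hpl : IsPicardLindelof (fun _ => v) (tmin := -(1 / (L + 1) : ℝ)) (tmax := 1 / (L + 1))
      ⟨0, by constructor <;> linarith⟩ x 1 0 L K := by
    refine IsPicardLindelof.of_time_independent hb hK' ?_
    simp only [sub_zero, zero_sub, neg_neg, max_self, NNReal.coe_one, NNReal.coe_zero]
    rw [mul_one_div, div_le_one (by positivity)]
    linarith
  obtain ⟨α, h0, hα⟩ := hpl.exists_eq_forall_mem_Icc_hasDerivWithinAt₀
  exact ⟨_, hε, α, h0, fun t ht =>
    (hα t (Ioo_subset_Icc_self ht)).hasDerivAt (Icc_mem_nhds ht.1 ht.2)⟩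

open Set Metric in
/-- Uniqueness for an autonomous equation whose vector field is Lipschitz on balls. -/
lemma eqOn_of_hasDerivAt_of_lipschitzOnWith_closedBall
    (hv : ∀ C : ℝ, ∃ K, LipschitzOnWith K v (closedBall 0 C)) {U : Set ℝ} (hU : IsOpen U)
    (hUc : U.OrdConnected) (h0 : (0 : ℝ) ∈ U) {f g : ℝ → E}
    (hf : ∀ t ∈ U, HasDerivAt f (v (f t)) t) (hg : ∀ t ∈ U, HasDerivAt g (v (g t)) t)
    (heq : f 0 = g 0) : EqOn f g U := by
  intro t ht
  -- Using `min 0 t` and `max 0 t` treats both signs of `t` at once. They lie strictly inside a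
  -- compact interval contained in `U`; both solutions are bounded there, hence stay in one ball on
  -- which `v` is Lipschitz.
  have hmin : min 0 t ∈ U := by rcases min_choice 0 t with h | h <;> rwa [h]
  have hmax : max 0 t ∈ U := by rcases max_choice 0 t with h | h <;> rwa [h]
  obtain ⟨a, ha, haU⟩ := exists_Ioc_subset_of_mem_nhds (hU.mem_nhds hmin) ⟨_, sub_one_lt _⟩
  obtain ⟨b, hb, hbU⟩ := exists_Ico_subset_of_mem_nhds (hU.mem_nhds hmax) ⟨_, lt_add_one _⟩
  obtain ⟨a', ha1, ha2⟩ := exists_between ha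
  obtain ⟨b', hb1, hb2⟩ := exists_between hb
  have hsub : Icc a' b' ⊆ U := hUc.out (haU ⟨ha1, ha2.le⟩) (hbU ⟨hb1.le, hb2⟩)
  have hfc : ContinuousOn f (Icc a' b') := fun s hs =>
    (hf s (hsub hs)).continuousAt.continuousWithinAt
  have hgc : ContinuousOn g (Icc a' b') := fun s hs =>
    (hg s (hsub hs)).continuousAt.continuousWithinAt
  obtain ⟨C, hC⟩ := isCompact_Icc.exists_bound_of_continuousOn hfc
  obtain ⟨D, hD⟩ := isCompact_Icc.exists_bound_of_continuousOn hgc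
  obtain ⟨K, hK⟩ := hv (max C D)
  have h0t := le_max_left 0 t
  have h0t' := min_le_left 0 t
  refine ODE_solution_unique_of_mem_Icc (v := fun _ => v) (s := fun _ => closedBall 0 (max C D))
    (t₀ := 0) (fun _ _ => hK) ⟨by linarith, by linarith⟩ hfc
    (fun s hs => hf s (hsub (Ioo_subset_Icc_self hs)))
    (fun s hs => ?_) hgc (fun s hs => hg s (hsub (Ioo_subset_Icc_self hs))) (fun s hs => ?_) heq
    ⟨by linarith [min_le_right 0 t], by linarith [le_max_right 0 t]⟩
  · rw [mem_closedBall_zero_iff]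
    exact (hC s (Ioo_subset_Icc_self hs)).trans (le_max_left _ _)
  · rw [mem_closedBall_zero_iff]
    exact (hD s (Ioo_subset_Icc_self hs)).trans (le_max_right _ _)

end ODE

/-! ### Completeness of the space of kernels and maximal trajectories -/

variable {Ω : Type*} [MeasurableSpace Ω]

/-- Kernels are the fixed points of the linear isometry induced by swapping coordinates. Closedness
yields the completeness that Picard–Lindelöf needs. -/
lemma isClosed_kernelSpace (π : Measure Ω) [IsProbabilityMeasure π] :
    IsClosed (kernelSpace π : Set (Lp ℝ ∞ (π.prod π))) := by
  have hs := Measure.measurePreserving_swap (μ := π) (ν := π)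
  have h : (kernelSpace π : Set (Lp ℝ ∞ (π.prod π)))
      = {W | Lp.compMeasurePreservingₗᵢ ℝ Prod.swap hs W = W} := by
    ext W
    change (∀ᵐ p ∂(π.prod π), W p.swap = W p) ↔ Lp.compMeasurePreserving Prod.swap hs W = W
    rw [Lp.ext_iff]
    have h1 := Lp.coeFn_compMeasurePreserving W hs
    constructor
    · intro h2
      filter_upwards [h1, h2] with p h3 h4
      rw [h3, Function.comp_apply, h4]
    · intro h2
      filter_upwards [h1, h2] with p h3 h4
      rw [← h4, h3, Function.comp_apply]
  rw [h]
  exact isClosed_eq (LinearIsometry.continuous _) continuous_id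

instance completeSpace_kernelSpace (π : Measure Ω) [IsProbabilityMeasure π] :
    CompleteSpace (kernelSpace π) :=
  (isClosed_kernelSpace π).completeSpace_coe

/-- Any two trajectories from `W` agree on the intersection of their domains, so all of them glue to
one function on the union. The union is again an interval because every domain contains 0. -/
lemma exists_isMaximalTrajectory_of_lipschitzOnWith {k : ℕ} {π : Measure Ω}
    [IsProbabilityMeasure π] (R : Rule k)
    (hR : ∀ C : ℝ, ∃ K, LipschitzOnWith K (velocity (π := π) R) (Metric.closedBall 0 C))
    (W : kernelSpace π) : ∃ I γ, IsMaximalTrajectory R W I γ := by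
  classical
  have huniq : ∀ {I J α β}, IsTrajectory R W I α → IsTrajectory R W J β →
      ∀ t, t ∈ I → t ∈ J → α t = β t := by
    intro I J α β hα hβ t hI hJ
    exact eqOn_of_hasDerivAt_of_lipschitzOnWith_closedBall hR (hα.isOpen.inter hβ.isOpen)
      (hα.ordConnected.inter hβ.ordConnected) ⟨hα.zero_mem, hβ.zero_mem⟩
      (fun s hs => hα.hasDerivAt s hs.1) (fun s hs => hβ.hasDerivAt s hs.2)
      (hα.initial.trans hβ.initial.symm) ⟨hI, hJ⟩
  let P : ℝ → Prop := fun t => ∃ q : Set ℝ × (ℝ → kernelSpace π), IsTrajectory R W q.1 q.2 ∧ t ∈ q.1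
  -- The chosen trajectory may change with `t`; by uniqueness this does not affect the value. The 0
  -- off the union is arbitrary.
  let γ : ℝ → kernelSpace π := fun t => if h : P t then h.choose.2 t else 0
  have hγ : ∀ {I α}, IsTrajectory R W I α → ∀ t ∈ I, γ t = α t := by
    intro I α hα t ht
    have h : P t := ⟨(I, α), hα, ht⟩
    change (if h : P t then h.choose.2 t else 0) = α t
    rw [dif_pos h]
    exact huniq h.choose_spec.1 hα t h.choose_spec.2 ht
  obtain ⟨ε, hε, α, hα0, hα⟩ := exists_hasDerivAt_Ioo_of_lipschitzOnWith_closedBall hR W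
  have hloc : IsTrajectory R W (Set.Ioo (-ε) ε) α :=
    ⟨isOpen_Ioo, Set.ordConnected_Ioo, ⟨by linarith, hε⟩, hα0, hα⟩
  refine ⟨{t | P t}, γ, ⟨?_, ?_, ⟨(_, _), hloc, hloc.zero_mem⟩, ?_, ?_⟩, ?_⟩
  · refine isOpen_iff_mem_nhds.2 ?_
    rintro t ⟨q, hq, ht⟩
    exact Filter.mem_of_superset (hq.isOpen.mem_nhds ht) fun s hs => ⟨q, hq, hs⟩
  · refine Set.ordConnected_of_uIcc_subset_left (x := 0) ?_
    rintro t ⟨q, hq, ht⟩ s hs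
    exact ⟨q, hq, hq.ordConnected.uIcc_subset hq.zero_mem ht hs⟩
  · exact (hγ hloc 0 hloc.zero_mem).trans hα0
  · rintro t ⟨q, hq, ht⟩
    rw [hγ hq t ht]
    exact (hq.hasDerivAt t ht).congr_of_eventuallyEq
      (Filter.mem_of_superset (hq.isOpen.mem_nhds ht) fun s hs => hγ hq s hs)
  · intro I β hβ
    exact ⟨fun t ht => ⟨(I, β), hβ, ht⟩, fun t ht => (hγ hβ t ht).symm⟩

/-- The two trajectories coincide on a neighbourhood of 0, so they have the same derivative there,
and these derivatives are the two velocities at `W`. -/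
lemma velocity_eq_of_sameTrajectories {k : ℕ} {π : Measure Ω} [IsProbabilityMeasure π]
    {R₁ R₂ : Rule k} (h : SameTrajectories π R₁ R₂) (W : kernelSpace π) :
    velocity R₁ W = velocity R₂ W := by
  obtain ⟨I, _, γ₁, γ₂, ⟨h₁, -⟩, ⟨h₂, -⟩, rfl, heq⟩ := h W
  have d₁ := h₁.hasDerivAt 0 h₁.zero_mem
  have d₂ := h₂.hasDerivAt 0 h₂.zero_mem
  rw [h₁.initial] at d₁
  rw [h₂.initial] at d₂
  exact d₁.unique (d₂.congr_of_eventuallyEq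
    (Filter.mem_of_superset (h₁.isOpen.mem_nhds h₁.zero_mem) heq))

lemma IsMaximalTrajectory.congr {k : ℕ} {π : Measure Ω} [IsProbabilityMeasure π]
    {R₁ R₂ : Rule k} (h : ∀ W : kernelSpace π, velocity R₁ W = velocity R₂ W)
    {W : kernelSpace π} {I : Set ℝ} {γ : ℝ → kernelSpace π} (hγ : IsMaximalTrajectory R₁ W I γ) :
    IsMaximalTrajectory R₂ W I γ := by
  have key : ∀ {R R' : Rule k}, (∀ W : kernelSpace π, velocity R W = velocity R' W) →
      ∀ {I γ}, IsTrajectory R W I γ → IsTrajectory R' W I γ := fun h _ _ hγ =>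
    ⟨hγ.isOpen, hγ.ordConnected, hγ.zero_mem, hγ.initial, fun t ht => h _ ▸ hγ.hasDerivAt t ht⟩
  exact ⟨key h hγ.isTrajectory, fun I' γ' h' => hγ.maximal I' γ' (key (fun W => (h W).symm) h')⟩

end FlipProcess

/-! ### Partitions of atomless probability spaces -/

namespace FlipProcess

variable {Ω : Type*} [MeasurableSpace Ω] {π : Measure Ω}

/-- In an atomless finite measure space, sets of positive measure have subsets of arbitrarily small
positive measure. -/
lemma IsAtomless.exists_subset_measure_le [IsFiniteMeasure π] (hπ : IsAtomless π) {s : Set Ω}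
    (hs : MeasurableSet s) (h0 : 0 < π s) {ε : ℝ≥0∞} (hε : 0 < ε) :
    ∃ t ⊆ s, MeasurableSet t ∧ 0 < π t ∧ π t ≤ ε := by
  -- Of a proper piece `t` and its complement in `u`, the lighter has at most half the mass;
  -- strictness of `π t < π u` keeps the complement non-null.
  have halve : ∀ u, MeasurableSet u → 0 < π u →
      ∃ t ⊆ u, MeasurableSet t ∧ 0 < π t ∧ π t ≤ π u / 2 := by
    intro u hu hu0
    obtain ⟨t, htu, ht, ht0, htlt⟩ := hπ u hu hu0
    have hadd : π t + π (u \ t) = π u := by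
      rw [← measure_inter_add_sdiff u ht, Set.inter_eq_self_of_subset_right htu]
    rcases le_total (π t) (π (u \ t)) with h | h
    · refine ⟨t, htu, ht, ht0, ?_⟩
      rw [ENNReal.le_div_iff_mul_le (by simp) (by simp), mul_two, ← hadd]
      gcongr
    · refine ⟨u \ t, Set.sdiff_subset, hu.diff ht, ?_, ?_⟩
      · rw [pos_iff_ne_zero]
        intro h1
        rw [h1, add_zero] at hadd
        exact htlt.ne hadd
      · rw [ENNReal.le_div_iff_mul_le (by simp) (by simp), mul_two, ← hadd]
        gcongr
  have hpow : ∀ n : ℕ, ∃ t ⊆ s, MeasurableSet t ∧ 0 < π t ∧ π t ≤ π s * (2⁻¹) ^ n := by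
    intro n
    induction n with
    | zero => exact ⟨s, subset_rfl, hs, h0, by simp⟩
    | succ n ih =>
      obtain ⟨t, hts, ht, ht0, hle⟩ := ih
      obtain ⟨u, hut, hu, hu0, hule⟩ := halve t ht ht0
      refine ⟨u, hut.trans hts, hu, hu0, hule.trans ?_⟩
      rw [pow_succ, ← mul_assoc, ENNReal.div_eq_inv_mul, mul_comm]
      gcongr
  have hlim : Filter.Tendsto (fun n : ℕ => π s * (2⁻¹ : ℝ≥0∞) ^ n) Filter.atTop (nhds 0) := by
    have h := ENNReal.Tendsto.const_mul (a := π s)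
      (ENNReal.tendsto_pow_atTop_nhds_zero_of_lt_one (r := 2⁻¹) (by simp))
      (Or.inr (measure_ne_top π s))
    simpa using h
  obtain ⟨n, hn⟩ := (hlim.eventually (gt_mem_nhds hε)).exists
  obtain ⟨t, hts, ht, ht0, hle⟩ := hpow n
  exact ⟨t, hts, ht, ht0, hle.trans hn.le⟩

/-- **Sierpiński's theorem**: the measures of the subsets of a set in an atomless finite measure
space fill an interval. -/
lemma IsAtomless.exists_subset_measure_eq [IsFiniteMeasure π] (hπ : IsAtomless π) {s : Set Ω}
    (hs : MeasurableSet s) {c : ℝ≥0∞} (hc : c ≤ π s) :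
    ∃ t ⊆ s, MeasurableSet t ∧ π t = c := by
  -- Greedy exhaustion: `S t` holds the masses that can still be added to `t` without exceeding `c`,
  -- and each step adds at least half of their supremum.
  let S : Set Ω → Set ℝ≥0∞ := fun t => {m | ∃ u ⊆ s \ t, MeasurableSet u ∧ π u + π t ≤ c ∧ m = π u}
  have step : ∀ t : {t : Set Ω // t ⊆ s ∧ MeasurableSet t ∧ π t ≤ c},
      ∃ t' : {t : Set Ω // t ⊆ s ∧ MeasurableSet t ∧ π t ≤ c},
        t.1 ⊆ t'.1 ∧ sSup (S t.1) / 2 ≤ π (t'.1 \ t.1) := by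
    rintro ⟨t, hts, ht, htc⟩
    have hex : ∃ m ∈ S t, sSup (S t) / 2 ≤ m := by
      by_cases h : sSup (S t) = 0
      · exact ⟨0, ⟨∅, Set.empty_subset _, .empty, by simpa using htc, by simp⟩, by simp [h]⟩
      · have hle : sSup (S t) ≤ π s := by
          refine sSup_le ?_
          rintro m ⟨u, hu, -, -, rfl⟩
          exact measure_mono (hu.trans Set.sdiff_subset)
        obtain ⟨m, hm, hlt⟩ := lt_sSup_iff.1
          (ENNReal.half_lt_self h (ne_top_of_le_ne_top (measure_ne_top π s) hle))
        exact ⟨m, hm, hlt.le⟩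
    obtain ⟨_, ⟨u, hu, hum, huc, rfl⟩, hle⟩ := hex
    have hdisj : Disjoint u t := Set.disjoint_of_subset_left hu Set.disjoint_sdiff_left
    refine ⟨⟨u ∪ t, Set.union_subset (hu.trans Set.sdiff_subset) hts, hum.union ht, ?_⟩,
      Set.subset_union_right, ?_⟩
    · rwa [measure_union hdisj ht]
    · simpa [hdisj.sdiff_eq_left] using hle
  choose next hnext1 hnext2 using step
  let T : ℕ → {t : Set Ω // t ⊆ s ∧ MeasurableSet t ∧ π t ≤ c} := fun n =>
    Nat.rec ⟨∅, Set.empty_subset _, .empty, by simp⟩ (fun _ t => next t) n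
  have hmono : Monotone fun n => (T n).1 := monotone_nat_of_le_succ fun n => hnext1 (T n)
  have hTm : MeasurableSet (⋃ n, (T n).1) := .iUnion fun n => (T n).2.2.1
  have hTs : ⋃ n, (T n).1 ⊆ s := Set.iUnion_subset fun n => (T n).2.1
  have hTc : π (⋃ n, (T n).1) ≤ c := by
    rw [hmono.measure_iUnion]
    exact iSup_le fun n => (T n).2.2.2
  refine ⟨_, hTs, hTm, le_antisymm hTc (not_lt.1 fun hlt => ?_)⟩
  have hpos : 0 < π (s \ ⋃ n, (T n).1) := by
    rw [measure_sdiff hTs hTm.nullMeasurableSet (measure_ne_top _ _)]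
    exact tsub_pos_of_lt (hlt.trans_le hc)
  -- If the limit fell short of `c`, a non-null `u` small enough to fit would remain. It was
  -- available at every stage, so every stage gained at least `π u / 2`, which is impossible in
  -- finite measure.
  obtain ⟨u, hus, hum, hu0, hule⟩ :=
    hπ.exists_subset_measure_le (hs.diff hTm) hpos (tsub_pos_of_lt hlt)
  have huS : ∀ n, π u / 2 ≤ π ((T (n + 1)).1 \ (T n).1) := by
    intro n
    refine le_trans ?_ (hnext2 (T n))
    have hu : π u ∈ S (T n).1 → sSup (S (T n).1) / 2 ≥ π u / 2 := fun h =>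
      ENNReal.div_le_div_right (le_sSup h) _
    refine hu ⟨u, hus.trans ?_, hum, ?_, rfl⟩
    · exact Set.sdiff_subset_sdiff_right (Set.subset_iUnion (fun n => (T n).1) n)
    · calc π u + π (T n).1 ≤ (c - π (⋃ n, (T n).1)) + π (⋃ n, (T n).1) := by
            gcongr
            exact Set.subset_iUnion (fun n => (T n).1) n
        _ = c := tsub_add_cancel_of_le hlt.le
  have hgrow : ∀ n : ℕ, n * (π u / 2) ≤ π (T n).1 := by
    intro n
    induction n with
    | zero => simp
    | succ n ih =>
      have h : π (T (n + 1)).1 = π (T n).1 + π ((T (n + 1)).1 \ (T n).1) := by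
        rw [← measure_inter_add_sdiff (T (n + 1)).1 (T n).2.2.1,
          Set.inter_eq_self_of_subset_right (hnext1 (T n))]
      rw [h, Nat.cast_succ, add_mul, one_mul]
      exact add_le_add ih (huS n)
  have hu2 : π u / 2 ≠ 0 := by simpa using hu0.ne'
  obtain ⟨n, hn⟩ := ENNReal.exists_nat_mul_gt hu2 (measure_ne_top π s)
  exact (hn.trans_le (hgrow n)).not_ge (measure_mono (T n).2.1)

/-- An atomless probability space has a measurable partition with any prescribed weights. -/
lemma IsAtomless.exists_measurable_label [IsProbabilityMeasure π] (hπ : IsAtomless π) {ι : Type*}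
    [Fintype ι] [MeasurableSpace ι] [Nonempty ι] [DiscreteMeasurableSpace ι]
    (α : ι → ℝ≥0∞) (hα : ∑ i, α i = 1) :
    ∃ h : Ω → ι, Measurable h ∧ ∀ i, π (h ⁻¹' {i}) = α i := by
  classical
  have key : ∀ S : Finset ι, ∃ A : ι → Set Ω, (∀ i, MeasurableSet (A i)) ∧
      (∀ i ∈ S, π (A i) = α i) ∧ (S : Set ι).PairwiseDisjoint A := by
    intro S
    induction S using Finset.induction_on with
    | empty => exact ⟨fun _ => ∅, fun _ => .empty, by simp, by simp⟩
    | insert j S hj ih =>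
      obtain ⟨A, hAm, hA, hAd⟩ := ih
      have hBm : MeasurableSet (⋃ i ∈ S, A i) := Finset.measurableSet_biUnion _ fun i _ => hAm i
      have hB : π (⋃ i ∈ S, A i) = ∑ i ∈ S, α i := by
        rw [measure_biUnion_finset hAd fun i _ => hAm i]
        exact Finset.sum_congr rfl hA
      have hle : α j ≤ π (⋃ i ∈ S, A i)ᶜ := by
        rw [prob_compl_eq_one_sub hBm, hB]
        refine ENNReal.le_sub_of_add_le_right ?_ ?_
        · refine ne_top_of_le_ne_top ENNReal.one_ne_top ?_
          rw [← hα]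
          exact Finset.sum_le_univ_sum_of_nonneg fun _ => zero_le
        · rw [← Finset.sum_insert hj, ← hα]
          exact Finset.sum_le_univ_sum_of_nonneg fun _ => zero_le
      obtain ⟨t, hts, ht, htα⟩ := hπ.exists_subset_measure_eq hBm.compl hle
      refine ⟨Function.update A j t, ?_, ?_, ?_⟩
      · intro i
        by_cases hi : i = j
        · subst hi; simpa using ht
        · simpa [hi] using hAm i
      · intro i hi
        by_cases hij : i = j
        · subst hij; simpa using htα
        · simpa [hij] using hA i ((Finset.mem_insert.1 hi).resolve_left hij)
      · rw [Finset.coe_insert, Set.pairwiseDisjoint_insert_of_notMem (by simpa using hj)]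
        have hne : ∀ i ∈ S, i ≠ j := fun i hi h => hj (h ▸ hi)
        constructor
        · intro i hi i' hi' hii'
          simpa [Function.onFun, hne i hi, hne i' hi'] using hAd hi hi' hii'
        · intro i hi
          simp only [Function.update_self, Function.update_of_ne (hne i hi)]
          exact Set.disjoint_of_subset_left hts (Set.disjoint_compl_left_iff_subset.2
            (Set.subset_biUnion_of_mem (u := A) hi))
  obtain ⟨A, hAm, hA, hAd⟩ := key Finset.univ
  have hdisj : ∀ i j, i ≠ j → Disjoint (A i) (A j) := fun i j hij => hAd (by simp) (by simp) hij
  obtain ⟨i₀⟩ := ‹Nonempty ι›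
  -- The sets have total mass 1, so the uncovered points are null and may all receive the label
  -- `i₀`.
  let h : Ω → ι := fun x => if hx : ∃ i, x ∈ A i then hx.choose else i₀
  have hmem : ∀ i x, x ∈ A i → h x = i := by
    intro i x hx
    have hex : ∃ i, x ∈ A i := ⟨i, hx⟩
    change (if hx : ∃ i, x ∈ A i then hx.choose else i₀) = i
    rw [dif_pos hex]
    by_contra hne
    exact Set.disjoint_left.1 (hdisj _ _ hne) hex.choose_spec hx
  have hpre : ∀ i, h ⁻¹' {i} = if i = i₀ then A i ∪ (⋃ j, A j)ᶜ else A i := by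
    intro i
    ext x
    by_cases hex : ∃ j, x ∈ A j
    · obtain ⟨j, hj⟩ := hex
      have h1 : x ∈ A i ↔ j = i := ⟨fun hi => (hmem j x hj).symm.trans (hmem i x hi), fun e => e ▸ hj⟩
      have h2 : x ∈ ⋃ j, A j := Set.mem_iUnion.2 ⟨j, hj⟩
      split_ifs <;> simp [hmem j x hj, h1]
      exact fun hx => absurd hj (hx j)
    · have h1 : h x = i₀ := dif_neg hex
      push Not at hex
      split_ifs with h3
      · simp [h1, h3, hex]
      · simp [h1, hex, Ne.symm h3]
  have hunion : π (⋃ j, A j)ᶜ = 0 := by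
    rw [prob_compl_eq_zero_iff (.iUnion hAm), measure_iUnion hdisj hAm, tsum_fintype, ← hα]
    exact Finset.sum_congr rfl fun i _ => hA i (Finset.mem_univ i)
  have hsing : ∀ i, MeasurableSet (h ⁻¹' {i}) := by
    intro i
    rw [hpre]
    split_ifs
    · exact (hAm i).union (MeasurableSet.iUnion hAm).compl
    · exact hAm i
  refine ⟨h, measurable_to_countable' hsing, fun i => ?_⟩
  rw [hpre]
  split_ifs
  · rw [measure_congr (union_ae_eq_left_of_ae_eq_empty (ae_eq_empty.2 hunion)),
      hA i (Finset.mem_univ i)]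
  · exact hA i (Finset.mem_univ i)

end FlipProcess

/-! ### Isomorphism invariance of densities and the Lipschitz estimate -/

namespace FlipProcess

/-- Telescoping: the factors are exchanged one at a time, each at cost `δ` times a product of
bounded factors. With `1 ≤ M` the exponent can be rounded up to `s.card`. -/
lemma abs_prod_sub_prod_le {ι : Type*} (s : Finset ι) {f g : ι → ℝ} {M δ : ℝ} (hM : 1 ≤ M)
    (hf : ∀ i ∈ s, |f i| ≤ M) (hg : ∀ i ∈ s, |g i| ≤ M) (hfg : ∀ i ∈ s, |f i - g i| ≤ δ) :
    |∏ i ∈ s, f i - ∏ i ∈ s, g i| ≤ s.card * M ^ s.card * δ := by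
  classical
  induction s using Finset.induction_on with
  | empty => simp
  | insert a s ha ih =>
    have ih' := ih (fun i hi => hf i (Finset.mem_insert_of_mem hi))
      (fun i hi => hg i (Finset.mem_insert_of_mem hi))
      (fun i hi => hfg i (Finset.mem_insert_of_mem hi))
    have ha' := Finset.mem_insert_self a s
    have hM0 : 0 ≤ M := zero_le_one.trans hM
    have hδ : 0 ≤ δ := (abs_nonneg _).trans (hfg a ha')
    have hfp : |∏ i ∈ s, f i| ≤ M ^ s.card := by
      rw [Finset.abs_prod]
      rw [← Finset.prod_const]
      exact Finset.prod_le_prod (fun _ _ => abs_nonneg _) fun i hi =>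
        hf i (Finset.mem_insert_of_mem hi)
    rw [Finset.prod_insert ha, Finset.prod_insert ha, Finset.card_insert_of_notMem ha]
    calc |f a * ∏ i ∈ s, f i - g a * ∏ i ∈ s, g i|
        = |(f a - g a) * ∏ i ∈ s, f i + g a * (∏ i ∈ s, f i - ∏ i ∈ s, g i)| := by ring_nf
      _ ≤ |f a - g a| * |∏ i ∈ s, f i| + |g a| * |∏ i ∈ s, f i - ∏ i ∈ s, g i| := by
          rw [← abs_mul, ← abs_mul]
          exact abs_add_le _ _
      _ ≤ δ * M ^ s.card + M * (s.card * M ^ s.card * δ) := by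
          gcongr
          · exact hfg a ha'
          · exact hg a ha'
      _ ≤ δ * M ^ (s.card + 1) + M * (s.card * M ^ s.card * δ) := by
          have := pow_le_pow_right₀ hM (Nat.le_succ s.card)
          gcongr
      _ = ((s.card + 1 : ℕ) : ℝ) * M ^ (s.card + 1) * δ := by push_cast; ring

/-- A product over unordered pairs is invariant under permutations. -/
lemma prod_Ioi_comp_perm {k : ℕ} {g : Fin k → Fin k → ℝ} (hg : ∀ i j, g i j = g j i)
    (φ : Equiv.Perm (Fin k)) :
    ∏ i, ∏ j ∈ Finset.Ioi i, g (φ i) (φ j) = ∏ i, ∏ j ∈ Finset.Ioi i, g i j := by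
  rw [Finset.prod_sigma', Finset.prod_sigma']
  refine Finset.prod_nbij'
    (fun p => if φ p.1 < φ p.2 then ⟨φ p.1, φ p.2⟩ else ⟨φ p.2, φ p.1⟩)
    (fun p => if φ.symm p.1 < φ.symm p.2 then ⟨φ.symm p.1, φ.symm p.2⟩
      else ⟨φ.symm p.2, φ.symm p.1⟩) ?_ ?_ ?_ ?_ ?_
  · rintro ⟨i, j⟩ h
    have hij : i < j := by simpa using h
    have := φ.injective.ne hij.ne
    dsimp only
    split_ifs with h1
    · simpa using h1
    · simpa using lt_of_le_of_ne (not_lt.1 h1) this.symm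
  · rintro ⟨i, j⟩ h
    have hij : i < j := by simpa using h
    have := φ.symm.injective.ne hij.ne
    dsimp only
    split_ifs with h1
    · simpa using h1
    · simpa using lt_of_le_of_ne (not_lt.1 h1) this.symm
  · rintro ⟨i, j⟩ h
    have hij : i < j := by simpa using h
    by_cases h1 : φ i < φ j <;> simp [h1, hij, hij.le]
  · rintro ⟨i, j⟩ h
    have hij : i < j := by simpa using h
    by_cases h1 : φ.symm i < φ.symm j <;> simp [h1, hij, hij.le]
  · rintro ⟨i, j⟩ h
    dsimp only
    split_ifs
    · rfl
    · exact hg _ _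

variable {Ω : Type*} {k : ℕ}

/-- An isomorphism permutes the unordered pairs and may reverse the chosen order inside a pair; this
is why `W` is symmetric at every point here, not just almost everywhere. -/
lemma inducedProd_comp_iso {F H : SimpleGraph (Fin k)} (φ : F ≃g H) {W : Ω × Ω → ℝ}
    (hW : ∀ p, W p.swap = W p) (x : Fin k → Ω) :
    inducedProd F W (x ∘ φ) = inducedProd H W x := by
  classical
  unfold inducedProd
  rw [← prod_Ioi_comp_perm (g := fun i j => if H.Adj i j then W (x i, x j) else 1 - W (x i, x j))
    (fun i j => by simp only [H.adj_comm i j, ← hW (x i, x j), Prod.swap]) φ.toEquiv]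
  refine Finset.prod_congr rfl fun i _ => Finset.prod_congr rfl fun j _ => ?_
  exact if_congr φ.map_adj_iff.symm rfl rfl

open Finset Classical in
lemma inducedProd_eq_prod_sigma (F : SimpleGraph (Fin k)) (W : Ω × Ω → ℝ) (x : Fin k → Ω) :
    inducedProd F W x = ∏ p ∈ (univ : Finset (Fin k)).sigma (fun i => Ioi i),
      if F.Adj p.1 p.2 then W (x p.1, x p.2) else 1 - W (x p.1, x p.2) := by
  rw [inducedProd, Finset.prod_sigma']

variable (k) in
/-- The constant by which the product of all pairs is Lipschitz on functions bounded by `C`. -/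
noncomputable def pairLipschitzConst (C : ℝ) : ℝ :=
  ((Finset.univ : Finset (Fin k)).sigma (fun i => Finset.Ioi i)).card *
    (1 + C) ^ ((Finset.univ : Finset (Fin k)).sigma (fun i => Finset.Ioi i)).card

lemma abs_inducedProd_sub_le (F : SimpleGraph (Fin k)) {U W : Ω × Ω → ℝ} {x : Fin k → Ω} {C δ : ℝ}
    (hC : 0 ≤ C) (hU : ∀ i j, i ≠ j → |U (x i, x j)| ≤ C) (hW : ∀ i j, i ≠ j → |W (x i, x j)| ≤ C)
    (h : ∀ i j, i ≠ j → |U (x i, x j) - W (x i, x j)| ≤ δ) :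
    |inducedProd F U x - inducedProd F W x| ≤ pairLipschitzConst k C * δ := by
  classical
  have hb : ∀ r : ℝ, |r| ≤ C → |1 - r| ≤ 1 + C := fun r hr =>
    (abs_sub _ _).trans (by rw [abs_one]; linarith)
  rw [inducedProd_eq_prod_sigma, inducedProd_eq_prod_sigma]
  refine abs_prod_sub_prod_le _ (by linarith) ?_ ?_ ?_
  all_goals
    rintro ⟨i, j⟩ hij
    have hne : i ≠ j := (Finset.mem_Ioi.1 (Finset.mem_sigma.1 hij).2).ne
    dsimp only
    split_ifs
  · linarith [hU i j hne]
  · exact hb _ (hU i j hne)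
  · linarith [hW i j hne]
  · exact hb _ (hW i j hne)
  · exact h i j hne
  · rw [sub_sub_sub_cancel_left, abs_sub_comm]
    exact h i j hne

variable [MeasurableSpace Ω]

/-- The isomorphism restricts to a bijection of the non-root vertices, and the corresponding
relabelling of integration variables preserves the product measure. -/
lemma densityFun_eq_of_iso (π : Measure Ω) [IsProbabilityMeasure π] {G H : RootedGraph k}
    (h : G.Iso H) {W : Ω × Ω → ℝ} (hW : ∀ p, W p.swap = W p) (p : Ω × Ω) :
    densityFun π G W p = densityFun π H W p := by
  obtain ⟨φ, h1, h2⟩ := h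
  have hmem : ∀ i, i ∈ ({G.fst, G.snd}ᶜ : Finset (Fin k)) ↔
      φ i ∈ ({H.fst, H.snd}ᶜ : Finset (Fin k)) := by
    intro i
    simp only [Finset.mem_compl, Finset.mem_insert, Finset.mem_singleton]
    rw [← h1, ← h2, φ.injective.eq_iff, φ.injective.eq_iff]
  let e : ↥({G.fst, G.snd}ᶜ : Finset (Fin k)) ≃ ↥({H.fst, H.snd}ᶜ : Finset (Fin k)) :=
    φ.toEquiv.subtypeEquiv hmem
  have hmp := measurePreserving_piCongrLeft (α := fun _ => Ω) (fun _ => π) e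
  unfold densityFun
  rw [← hmp.integral_comp']
  congr 1
  funext z
  rw [← inducedProd_comp_iso φ hW]
  congr 1
  funext i
  simp only [Function.comp_apply, assign]
  by_cases ha : i = G.fst
  · rw [dif_pos ha, dif_pos (by rw [ha, h1])]
  have ha' : φ i ≠ H.fst := by rwa [← h1, φ.injective.ne_iff]
  rw [dif_neg ha, dif_neg ha']
  by_cases hb : i = G.snd
  · rw [dif_pos hb, dif_pos (by rw [hb, h2])]
  have hb' : φ i ≠ H.snd := by rwa [← h2, φ.injective.ne_iff]
  rw [dif_neg hb, dif_neg hb']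
  exact (Equiv.piCongrLeft_apply_apply (fun _ => Ω) e z
    ⟨i, by simp [ha, hb]⟩).symm

variable {π : Measure Ω} [IsProbabilityMeasure π]

/-- Two distinct coordinates are jointly distributed as `π.prod π`. For `i = j` this fails, since
the diagonal may be null; induced products use only distinct pairs. -/
lemma ae_pairs {P : Ω × Ω → Prop} (h : ∀ᵐ p ∂(π.prod π), P p) :
    ∀ᵐ x ∂(Measure.pi fun _ : Fin k => π), ∀ i j, i ≠ j → P (x i, x j) := by
  refine ae_all_iff.2 fun i => ae_all_iff.2 fun j => ?_
  by_cases hij : i = j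
  · simp [hij]
  · filter_upwards [(measurePreserving_pair π hij).quasiMeasurePreserving.ae h] with x hx _
    exact hx

lemma ae_ae_assign {a b : Fin k} (hab : a ≠ b) {P : (Fin k → Ω) → Prop}
    (h : ∀ᵐ x ∂(Measure.pi fun _ => π), P x) :
    ∀ᵐ p ∂(π.prod π), ∀ᵐ z ∂(Measure.pi fun _ => π), P (assign a b p z) :=
  Measure.ae_ae_of_ae_prod ((measurePreserving_assign π hab).quasiMeasurePreserving.ae h)

lemma densityFun_congr_ae (G : RootedGraph k) {U W : Ω × Ω → ℝ} (h : U =ᵐ[π.prod π] W) :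
    densityFun π G U =ᵐ[π.prod π] densityFun π G W := by
  have hx : ∀ᵐ x ∂(Measure.pi fun _ : Fin k => π),
      inducedProd G.graph U x = inducedProd G.graph W x := by
    filter_upwards [ae_pairs h] with x hx
    refine Finset.prod_congr rfl fun i _ => Finset.prod_congr rfl fun j hj => ?_
    rw [hx i j (Finset.mem_Ioi.1 hj).ne]
  filter_upwards [ae_ae_assign G.2.2 hx] with p hp
  exact integral_congr_ae hp

/-- Isomorphic rooted graphs have the same density. -/
lemma rootedDensity_eq_of_iso {G H : RootedGraph k} (h : G.Iso H) (W : kernelSpace π) :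
    rootedDensity G W = rootedDensity H W := by
  set U : Ω × Ω → ℝ := ((W : Lp ℝ ∞ (π.prod π)) : Ω × Ω → ℝ) with hU
  -- Averaging with the swap gives a representative of `W` that is symmetric everywhere, as the
  -- pointwise invariance requires.
  let V : Ω × Ω → ℝ := fun p => (U p + U p.swap) / 2
  have hV : ∀ p, V p.swap = V p := fun p => by
    simp only [V, Prod.swap_swap]
    ring
  have hUV : U =ᵐ[π.prod π] V := by
    have hW : ∀ᵐ p ∂(π.prod π), U p.swap = U p := W.2
    filter_upwards [hW] with p hp
    simp only [V, hp]
    ring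
  refine (MemLp.toLp_eq_toLp_iff _ _).2 ?_
  refine (densityFun_congr_ae G hUV).trans
    (Filter.EventuallyEq.trans ?_ (densityFun_congr_ae H hUV).symm)
  exact Filter.Eventually.of_forall fun p => densityFun_eq_of_iso π h hV p

open scoped Classical in
lemma velocity_eq_sum_orbitCoeff (R : Rule k) (W : kernelSpace π) :
    (velocity R W : Lp ℝ ∞ (π.prod π))
      = ∑ J : RootedClass k, R.orbitCoeff J • rootedDensity J.out W := by
  change ∑ G : RootedGraph k, R.coeff G • rootedDensity G W = _
  rw [← Finset.sum_fiberwise Finset.univ (fun G => (⟦G⟧ : RootedClass k))]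
  refine Finset.sum_congr rfl fun J _ => ?_
  rw [Rule.orbitCoeff, Finset.sum_smul]
  refine Finset.sum_congr rfl fun G hG => ?_
  rw [rootedDensity_eq_of_iso]
  have h : (⟦G⟧ : RootedClass k) = ⟦J.out⟧ := by
    rw [Quotient.out_eq]
    exact (Finset.mem_filter.1 hG).2
  exact Quotient.exact h

lemma velocity_eq_of_orbitCoeff_eq {R₁ R₂ : Rule k}
    (h : ∀ J, R₁.orbitCoeff J = R₂.orbitCoeff J) (W : kernelSpace π) :
    velocity R₁ W = velocity R₂ W := by
  refine Subtype.ext ?_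
  rw [velocity_eq_sum_orbitCoeff, velocity_eq_sum_orbitCoeff]
  simp only [h]

lemma integrable_of_abs_pairs_le {a b : Fin k} (F : SimpleGraph (Fin k)) {W : Ω × Ω → ℝ}
    (hWm : Measurable W) {C : ℝ} {p : Ω × Ω}
    (hW : ∀ᵐ z ∂(Measure.pi fun _ => π), ∀ i j, i ≠ j →
      |W (assign a b p z i, assign a b p z j)| ≤ C) :
    Integrable (fun z => inducedProd F W (assign a b p z)) (Measure.pi fun _ => π) := by
  have hm : Measurable fun z => inducedProd F W (assign a b p z) :=
    (measurable_inducedProd F hWm).comp ((measurable_assign a b).comp measurable_prodMk_left)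
  classical
  refine Integrable.of_bound hm.aestronglyMeasurable
    ((1 + C) ^ ((Finset.univ : Finset (Fin k)).sigma (fun i => Finset.Ioi i)).card) ?_
  filter_upwards [hW] with z hz
  rw [Real.norm_eq_abs, inducedProd_eq_prod_sigma, Finset.abs_prod]
  rw [← Finset.prod_const]
  refine Finset.prod_le_prod (fun _ _ => abs_nonneg _) ?_
  rintro ⟨i, j⟩ hij
  have h := hz i j (Finset.mem_Ioi.1 (Finset.mem_sigma.1 hij).2).ne
  dsimp only
  split_ifs
  · linarith
  · exact (abs_sub _ _).trans (by rw [abs_one]; linarith)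

/-- For almost every pair of roots and almost every choice of the other points, the integrands
satisfy the bound of `abs_inducedProd_sub_le`; integrating over a probability space preserves it. -/
lemma norm_rootedDensity_sub_le (G : RootedGraph k) {U W : kernelSpace π} {C : ℝ} (hC : 0 ≤ C)
    (hU : ‖U‖ ≤ C) (hW : ‖W‖ ≤ C) :
    ‖rootedDensity G U - rootedDensity G W‖ ≤ pairLipschitzConst k C * ‖U - W‖ := by
  have hL : 0 ≤ pairLipschitzConst k C := by unfold pairLipschitzConst; positivity
  have hae : ∀ V : kernelSpace π, ∀ᵐ p ∂(π.prod π), |(V : Lp ℝ ∞ (π.prod π)) p| ≤ ‖V‖ := by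
    intro V
    have h := ae_le_lpNorm_exponent_top (Lp.memLp (V : Lp ℝ ∞ (π.prod π)))
    rwa [← toReal_eLpNorm (Lp.aestronglyMeasurable _), ← Lp.norm_def] at h
  have hsub : ∀ᵐ p ∂(π.prod π),
      |(U : Lp ℝ ∞ (π.prod π)) p - (W : Lp ℝ ∞ (π.prod π)) p| ≤ ‖U - W‖ := by
    filter_upwards [hae (U - W), Lp.coeFn_sub (U : Lp ℝ ∞ (π.prod π)) W] with p h1 h2
    rwa [Submodule.coe_sub, h2, Pi.sub_apply] at h1
  have hm : ∀ V : kernelSpace π, Measurable ((V : Lp ℝ ∞ (π.prod π)) : Ω × Ω → ℝ) := fun V =>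
    (Lp.stronglyMeasurable _).measurable
  refine (Lp.norm_le_of_ae_bound (C := pairLipschitzConst k C * ‖U - W‖) (by positivity) ?_).trans
    (by simp)
  filter_upwards [Lp.coeFn_sub (rootedDensity G U) (rootedDensity G W),
    (memLp_densityFun G (U : Lp ℝ ∞ (π.prod π))).coeFn_toLp,
    (memLp_densityFun G (W : Lp ℝ ∞ (π.prod π))).coeFn_toLp,
    ae_ae_assign G.2.2 (ae_pairs (hae U)), ae_ae_assign G.2.2 (ae_pairs (hae W)),
    ae_ae_assign G.2.2 (ae_pairs hsub)] with p h1 h2 h3 h4 h5 h6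
  have h4' : ∀ᵐ z ∂(Measure.pi fun _ => π), ∀ i j, i ≠ j →
      |(U : Lp ℝ ∞ (π.prod π)) (assign G.fst G.snd p z i, assign G.fst G.snd p z j)| ≤ C := by
    filter_upwards [h4] with z hz i j hij using (hz i j hij).trans hU
  have h5' : ∀ᵐ z ∂(Measure.pi fun _ => π), ∀ i j, i ≠ j →
      |(W : Lp ℝ ∞ (π.prod π)) (assign G.fst G.snd p z i, assign G.fst G.snd p z j)| ≤ C := by
    filter_upwards [h5] with z hz i j hij using (hz i j hij).trans hW
  rw [h1, Pi.sub_apply, rootedDensity, rootedDensity, h2, h3, densityFun, densityFun,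
    ← integral_sub (integrable_of_abs_pairs_le _ (hm U) h4')
      (integrable_of_abs_pairs_le _ (hm W) h5')]
  refine (norm_integral_le_of_norm_le_const (C := pairLipschitzConst k C * ‖U - W‖) ?_).trans
    (by simp)
  filter_upwards [h4', h5', h6] with z h7 h8 h9
  exact abs_inducedProd_sub_le _ hC h7 h8 h9

/-- The velocity operator is Lipschitz on balls. -/
lemma exists_lipschitzOnWith_velocity (R : Rule k) (C : ℝ) :
    ∃ K, LipschitzOnWith K (velocity (π := π) R) (Metric.closedBall 0 C) := by
  rcases lt_or_ge C 0 with hC | hC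
  · exact ⟨0, by simp [Metric.closedBall_eq_empty.2 hC]⟩
  refine ⟨Real.toNNReal (∑ G : RootedGraph k, |R.coeff G| * pairLipschitzConst k C),
    LipschitzOnWith.of_dist_le' fun U hU W hW => ?_⟩
  rw [mem_closedBall_zero_iff] at hU hW
  rw [dist_eq_norm, dist_eq_norm, Finset.sum_mul]
  change ‖∑ G : RootedGraph k, R.coeff G • rootedDensity G U
    - ∑ G : RootedGraph k, R.coeff G • rootedDensity G W‖ ≤ _
  rw [← Finset.sum_sub_distrib]
  refine norm_sum_le_of_le _ fun G _ => ?_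
  rw [← smul_sub, norm_smul, Real.norm_eq_abs, mul_assoc]
  gcongr
  exact norm_rootedDensity_sub_le G hC hU hW

lemma sameTrajectories_of_velocity_eq {R₁ R₂ : Rule k}
    (h : ∀ W : kernelSpace π, velocity R₁ W = velocity R₂ W) : SameTrajectories π R₁ R₂ := by
  intro W
  obtain ⟨I, γ, hγ⟩ := exists_isMaximalTrajectory_of_lipschitzOnWith R₁
    (exists_lipschitzOnWith_velocity R₁) W
  exact ⟨I, I, γ, γ, hγ, hγ.congr h, rfl, fun _ _ => rfl⟩

end FlipProcess

/-! ### Counting isomorphisms and extracting a coefficient -/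

namespace FlipProcess

variable {k : ℕ}

/-- The number of isomorphisms between two rooted graphs. -/
noncomputable def RootedGraph.isoCount (G H : RootedGraph k) : ℕ :=
  {φ : Equiv.Perm (Fin k) | (∀ i j, G.graph.Adj i j ↔ H.graph.Adj (φ i) (φ j)) ∧
    φ G.fst = H.fst ∧ φ G.snd = H.snd}.ncard

lemma RootedGraph.isoCount_eq_zero {G H : RootedGraph k} (h : ¬ G.Iso H) : G.isoCount H = 0 := by
  rw [isoCount, Set.ncard_eq_zero, Set.eq_empty_iff_forall_notMem]
  rintro φ ⟨h1, h2⟩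
  exact h ⟨⟨φ, fun {i j} => (h1 i j).symm⟩, h2⟩

lemma RootedGraph.isoCount_self_ne_zero (H : RootedGraph k) : H.isoCount H ≠ 0 := by
  refine (Set.ncard_pos (Set.toFinite _)).2 ⟨1, ?_⟩ |>.ne'
  simp

/-- Precomposition with the inverse of a fixed isomorphism `G → H` is a bijection from the
isomorphisms `G → H` to the automorphisms of `H`. -/
lemma RootedGraph.isoCount_eq_of_iso {G H : RootedGraph k} (h : G.Iso H) :
    G.isoCount H = H.isoCount H := by
  obtain ⟨ψ, h1, h2⟩ := h
  refine Set.ncard_congr (fun φ _ => ψ.toEquiv.symm.trans φ) ?_ ?_ ?_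
  · rintro φ ⟨h3, h4, h5⟩
    refine ⟨fun i j => ?_, ?_, ?_⟩
    · rw [← ψ.symm.map_adj_iff]
      exact h3 _ _
    · exact (congrArg φ (ψ.toEquiv.symm_apply_eq.2 h1.symm)).trans h4
    · exact (congrArg φ (ψ.toEquiv.symm_apply_eq.2 h2.symm)).trans h5
  · intro φ φ' _ _ h
    ext i
    have := DFunLike.congr_fun h (ψ.toEquiv i)
    simp only [Equiv.trans_apply, Equiv.symm_apply_apply] at this
    rw [this]
  · rintro φ ⟨h3, h4, h5⟩
    refine ⟨ψ.toEquiv.trans φ, ⟨fun i j => ?_, ?_, ?_⟩, ?_⟩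
    · rw [← ψ.map_adj_iff]
      exact h3 _ _
    · exact (congrArg φ h1).trans h4
    · exact (congrArg φ h2).trans h5
    · ext i
      simp

open scoped Classical in
/-- The sum of the coefficients weighted by numbers of isomorphisms to `H` is a multiple of the
orbit coefficient of the class of `H`. -/
lemma sum_coeff_mul_isoCount (R : Rule k) (H : RootedGraph k) :
    ∑ G : RootedGraph k, R.coeff G * G.isoCount H = H.isoCount H * R.orbitCoeff ⟦H⟧ := by
  rw [Rule.orbitCoeff, Finset.mul_sum, Finset.sum_filter]
  refine Finset.sum_congr rfl fun G _ => ?_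
  split_ifs with h
  · rw [RootedGraph.isoCount_eq_of_iso (Quotient.exact h), mul_comm]
  · rw [RootedGraph.isoCount_eq_zero fun h' => h (Quotient.sound h'), Nat.cast_zero, mul_zero]

open scoped Classical in
/-- The adjacency indicator of a graph as a function on pairs. -/
noncomputable def adjFun {ι : Type*} (H : SimpleGraph ι) (p : ι × ι) : ℝ := if H.Adj p.1 p.2 then 1 else 0

-- Each factor is the indicator that `F` and `H` agree on one pair `i < j`. Reversed pairs follow by
-- symmetry, diagonal ones by the absence of loops.
open scoped Classical in
lemma inducedProd_adjFun_perm (F H : SimpleGraph (Fin k)) (φ : Equiv.Perm (Fin k)) :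
    inducedProd F (adjFun H) φ = if ∀ i j, F.Adj i j ↔ H.Adj (φ i) (φ j) then 1 else 0 := by
  rw [inducedProd_eq_prod_sigma]
  split_ifs with h
  · refine Finset.prod_eq_one fun p _ => ?_
    rw [adjFun]
    split_ifs with h1 h2 h2
    · rfl
    · exact absurd ((h _ _).1 h1) h2
    · exact absurd ((h _ _).2 h2) h1
    · simp
  · have hlt : ∃ i j, i < j ∧ ¬ (F.Adj i j ↔ H.Adj (φ i) (φ j)) := by
      push Not at h
      by_contra! hcon
      refine h.elim fun i hi => hi.elim fun j hj => ?_
      have hij : F.Adj i j ↔ H.Adj (φ i) (φ j) := by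
        rcases lt_trichotomy i j with h1 | rfl | h1
        · exact hcon i j h1
        · simp
        · rw [F.adj_comm, H.adj_comm]
          exact hcon j i h1
      tauto
    obtain ⟨i, j, hij, hne⟩ := hlt
    refine Finset.prod_eq_zero (i := ⟨i, j⟩) (by simpa using hij) ?_
    rw [adjFun]
    dsimp only
    split_ifs with h1 h2 h2
    · exact absurd (iff_of_true h1 h2) hne
    · rfl
    · simp
    · exact absurd (iff_of_false h1 h2) hne

open scoped Classical in
/-- The weight of a map `φ` of vertex sets in the density of `G` in a step graphon with parts
labelled by the vertices of `H`. -/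
noncomputable def mapWeight (G H : RootedGraph k) (φ : Fin k → Fin k) : ℝ :=
  (if φ G.fst = H.fst ∧ φ G.snd = H.snd then 1 else 0) * inducedProd G.graph (adjFun H.graph) φ

lemma sum_perm_mapWeight (G H : RootedGraph k) :
    ∑ φ : Equiv.Perm (Fin k), mapWeight G H φ = G.isoCount H := by
  classical
  rw [RootedGraph.isoCount, Set.ncard_eq_toFinset_card', Finset.card_eq_sum_ones, Nat.cast_sum,
    Set.toFinset_ofPred, Finset.sum_filter]
  refine Finset.sum_congr rfl fun φ _ => ?_
  rw [mapWeight, inducedProd_adjFun_perm, ite_zero_mul_ite_zero, mul_one, Nat.cast_one]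
  exact if_congr and_comm rfl rfl

/-- A polynomial vanishing on the positive orthant is zero, and the sum over permutations is its
coefficient at the product of all the variables. -/
lemma sum_perm_eq_zero_of_forall_pos {w : (Fin k → Fin k) → ℝ}
    (h : ∀ α : Fin k → ℝ, (∀ i, 0 < α i) → ∑ φ, w φ * ∏ i, α (φ i) = 0) :
    ∑ φ : Equiv.Perm (Fin k), w φ = 0 := by
  classical
  let P : MvPolynomial (Fin k) ℝ := ∑ φ, MvPolynomial.C (w φ) * ∏ i, MvPolynomial.X (φ i)
  have hP : P = 0 := by
    refine MvPolynomial.funext_set (fun _ => Set.Ioi 0) (fun _ => Set.Ioi_infinite 0) ?_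
    intro α hα
    simpa [P, map_sum, map_prod] using h α fun i => hα i (Set.mem_univ i)
  have hmon : ∀ φ : Fin k → Fin k, ∏ i, (MvPolynomial.X (φ i) : MvPolynomial (Fin k) ℝ)
      = MvPolynomial.monomial (∑ i, Finsupp.single (φ i) 1) 1 := fun φ => by
    rw [MvPolynomial.monomial_sum_one]
    rfl
  -- The exponent of the variable `j` is the number of preimages of `j` under `φ`, so all exponents
  -- equal 1 exactly for bijections.
  have hbij : ∀ φ : Fin k → Fin k,
      ∑ i, Finsupp.single (φ i) 1 = (∑ i, Finsupp.single i 1 : Fin k →₀ ℕ)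
        ↔ Function.Bijective φ := by
    intro φ
    constructor
    · intro h
      refine Finite.surjective_iff_bijective.1 fun j => ?_
      have hj := DFunLike.congr_fun h j
      simp only [Finsupp.coe_finsetSum, Finset.sum_apply, Finsupp.single_apply] at hj
      by_contra! hne
      simp [hne] at hj
    · intro h
      exact h.sum_comp fun j => Finsupp.single j 1
  have hc := congrArg (MvPolynomial.coeff (∑ i, Finsupp.single i 1)) hP
  simp only [P, MvPolynomial.coeff_sum, hmon, MvPolynomial.coeff_C_mul, MvPolynomial.coeff_monomial,
    hbij, MvPolynomial.coeff_zero, mul_ite, mul_one, mul_zero] at hc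
  rw [← hc, ← Finset.sum_filter]
  refine Finset.sum_bij (fun φ _ => ⇑φ) ?_ ?_ ?_ ?_
  · intro φ _
    exact Finset.mem_filter.2 ⟨Finset.mem_univ _, φ.bijective⟩
  · intro φ _ ψ _ h
    exact DFunLike.coe_injective h
  · intro φ hφ
    exact ⟨Equiv.ofBijective φ (Finset.mem_filter.1 hφ).2, Finset.mem_univ _, rfl⟩
  · intro φ _
    rfl

/-! ### Step graphons and the recovery of the orbit coefficients -/

variable {Ω : Type*} [MeasurableSpace Ω] {π : Measure Ω} [IsProbabilityMeasure π]

open scoped Classical in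
/-- The integral of a rooted density of a step function over a product of two parts. -/
lemma integral_indicator_mul_densityFun (G : RootedGraph k) {h : Ω → Fin k} (hh : Measurable h)
    {w : Fin k × Fin k → ℝ} (c d : Fin k) :
    Integrable (fun p : Ω × Ω => (if h p.1 = c ∧ h p.2 = d then (1 : ℝ) else 0) *
      densityFun π G (fun p => w (h p.1, h p.2)) p) (π.prod π) ∧
    ∫ p : Ω × Ω, (if h p.1 = c ∧ h p.2 = d then (1 : ℝ) else 0) *
      densityFun π G (fun p => w (h p.1, h p.2)) p ∂(π.prod π)
    = ∑ φ : Fin k → Fin k, ((if φ G.fst = c ∧ φ G.snd = d then 1 else 0) *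
        inducedProd G.graph w φ) * ∏ i, π.real (h ⁻¹' {φ i}) := by
  let g : (Fin k → Fin k) → ℝ := fun φ =>
    (if φ G.fst = c ∧ φ G.snd = d then 1 else 0) * inducedProd G.graph w φ
  let lab : (Fin k → Ω) → Fin k → Fin k := fun x i => h (x i)
  have hlab : Measurable lab := by fun_prop
  have hne : G.snd ≠ G.fst := G.2.2.symm
  have hmp := measurePreserving_assign π G.2.2
  have hg : Measurable g := measurable_of_finite g
  have hint : Integrable (fun q : (Ω × Ω) × (↥({G.fst, G.snd}ᶜ : Finset (Fin k)) → Ω) =>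
      g (lab (assign G.fst G.snd q.1 q.2))) ((π.prod π).prod (Measure.pi fun _ => π)) := by
    obtain ⟨C, hC⟩ := Finite.exists_le fun φ => ‖g φ‖
    exact Integrable.of_bound
      ((hg.comp hlab).comp (measurable_assign _ _)).aestronglyMeasurable C
      (Filter.Eventually.of_forall fun q => hC _)
  have hfun : (fun p : Ω × Ω => (if h p.1 = c ∧ h p.2 = d then (1 : ℝ) else 0) *
      densityFun π G (fun p => w (h p.1, h p.2)) p)
      = fun p => ∫ z, g (lab (assign G.fst G.snd p z)) ∂(Measure.pi fun _ => π) := by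
    funext p
    rw [densityFun, ← integral_const_mul]
    refine integral_congr_ae (Filter.Eventually.of_forall fun z => ?_)
    have h1 : assign G.fst G.snd p z G.fst = p.1 := by simp [assign]
    have h2 : assign G.fst G.snd p z G.snd = p.2 := by simp [assign, hne]
    change _ = (if h (assign G.fst G.snd p z G.fst) = c ∧ h (assign G.fst G.snd p z G.snd) = d
      then (1 : ℝ) else 0) * _
    rw [h1, h2]
    rfl
  rw [hfun]
  refine ⟨hint.integral_prod_left, ?_⟩
  have hpi : (Measure.pi fun _ : Fin k => π).map lab = Measure.pi fun _ => π.map h := by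
    have : IsProbabilityMeasure (π.map h) := Measure.isProbabilityMeasure_map hh.aemeasurable
    exact Measure.pi_map_pi (f := fun _ => h) fun _ => hh.aemeasurable
  have : IsProbabilityMeasure (π.map h) := Measure.isProbabilityMeasure_map hh.aemeasurable
  -- Fubini merges roots and non-roots into one integral over `Fin k → Ω`. The integrand depends
  -- only on the labels, which are independent, so it becomes a finite sum weighted by products of
  -- part masses.
  calc ∫ p, ∫ z, g (lab (assign G.fst G.snd p z)) ∂(Measure.pi fun _ => π) ∂(π.prod π)
      = ∫ q : (Ω × Ω) × (↥({G.fst, G.snd}ᶜ : Finset (Fin k)) → Ω),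
          g (lab (assign G.fst G.snd q.1 q.2)) ∂((π.prod π).prod (Measure.pi fun _ => π)) :=
        (integral_prod _ hint).symm
    _ = ∫ x, g (lab x) ∂(Measure.pi fun _ => π) := by
        rw [← hmp.map_eq]
        exact (integral_map hmp.measurable.aemeasurable
          (hg.comp hlab).aestronglyMeasurable).symm
    _ = ∫ φ, g φ ∂(Measure.pi fun _ => π.map h) := by
        rw [← hpi, integral_map hlab.aemeasurable hg.aestronglyMeasurable]
    _ = _ := by
        rw [integral_fintype .of_finite]
        refine Finset.sum_congr rfl fun φ _ => ?_
        rw [smul_eq_mul, mul_comm, measureReal_def, Measure.pi_singleton, ENNReal.toReal_prod]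
        congr 1
        refine Finset.prod_congr rfl fun i _ => ?_
        rw [Measure.map_apply hh (measurableSet_singleton _), measureReal_def]

/-- The step graphon of a graph on the labels of a measurable labelling. -/
lemma exists_step_graphon (H : SimpleGraph (Fin k)) {h : Ω → Fin k} (hh : Measurable h) :
    ∃ W : kernelSpace π, IsGraphon W ∧
      (W : Lp ℝ ∞ (π.prod π)) =ᵐ[π.prod π] fun p => adjFun H (h p.1, h p.2) := by
  classical
  have hm : Measurable fun p : Ω × Ω => adjFun H (h p.1, h p.2) :=
    (measurable_of_finite (adjFun H)).comp (by fun_prop)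
  have h01 : ∀ p, adjFun H p ∈ Set.Icc (0 : ℝ) 1 := fun p => by
    unfold adjFun
    split_ifs <;> simp
  have hmem : MemLp (fun p : Ω × Ω => adjFun H (h p.1, h p.2)) ∞ (π.prod π) :=
    memLp_top_of_bound hm.aestronglyMeasurable 1 (Filter.Eventually.of_forall fun p => by
      rw [Real.norm_eq_abs, abs_of_nonneg (h01 _).1]
      exact (h01 _).2)
  have hae := hmem.coeFn_toLp
  have hsymm : hmem.toLp _ ∈ kernelSpace π := by
    have h' := (Measure.measurePreserving_swap (μ := π) (ν := π)).quasiMeasurePreserving.ae hae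
    change ∀ᵐ p ∂(π.prod π), _
    filter_upwards [hae, h'] with p h1 h2
    rw [h1, h2]
    simp only [adjFun, Prod.fst_swap, Prod.snd_swap, H.adj_comm]
  refine ⟨⟨hmem.toLp _, hsymm⟩, ?_, hae⟩
  change ∀ᵐ p ∂(π.prod π), hmem.toLp _ p ∈ Set.Icc (0 : ℝ) 1
  filter_upwards [hae] with p hp
  rw [hp]
  exact h01 _

/-- Allows the actual step function to replace the representative of its class in `Lp`. -/
lemma coeFn_velocity (R : Rule k) (W : kernelSpace π) {U : Ω × Ω → ℝ}
    (hU : (W : Lp ℝ ∞ (π.prod π)) =ᵐ[π.prod π] U) :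
    (velocity R W : Lp ℝ ∞ (π.prod π))
      =ᵐ[π.prod π] fun p => ∑ G : RootedGraph k, R.coeff G * densityFun π G U p := by
  have h1 : ∀ᵐ p ∂(π.prod π), ∀ G : RootedGraph k, (R.coeff G • rootedDensity G W) p
      = R.coeff G * densityFun π G U p := by
    refine ae_all_iff.2 fun G => ?_
    filter_upwards [Lp.coeFn_smul (R.coeff G) (rootedDensity G W),
      (memLp_densityFun G (W : Lp ℝ ∞ (π.prod π))).coeFn_toLp, densityFun_congr_ae G hU]
      with p h2 h3 h4
    rw [h2, Pi.smul_apply, smul_eq_mul, rootedDensity, h3, h4]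
  filter_upwards [Lp.coeFn_finsetSum Finset.univ
    fun G : RootedGraph k => R.coeff G • rootedDensity G W, h1] with p h2 h3
  change (∑ G : RootedGraph k, R.coeff G • rootedDensity G W : Lp ℝ ∞ (π.prod π)) p = _
  rw [h2, Finset.sum_apply]
  exact Finset.sum_congr rfl fun G _ => h3 G

open scoped Classical in
/-- The integral of the velocity of a step graphon over a product of two parts. -/
lemma integral_indicator_mul_velocity (R : Rule k) (H : RootedGraph k) {h : Ω → Fin k}
    (hh : Measurable h) {W : kernelSpace π}
    (hW : (W : Lp ℝ ∞ (π.prod π)) =ᵐ[π.prod π] fun p => adjFun H.graph (h p.1, h p.2)) :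
    ∫ p : Ω × Ω, (if h p.1 = H.fst ∧ h p.2 = H.snd then (1 : ℝ) else 0) *
      (velocity R W : Lp ℝ ∞ (π.prod π)) p ∂(π.prod π)
    = ∑ φ : Fin k → Fin k, (∑ G : RootedGraph k, R.coeff G * mapWeight G H φ) *
        ∏ i, π.real (h ⁻¹' {φ i}) := by
  have hI := fun G : RootedGraph k =>
    integral_indicator_mul_densityFun (π := π) G hh (w := adjFun H.graph) H.fst H.snd
  calc _ = ∫ p : Ω × Ω, ∑ G : RootedGraph k, R.coeff G *
        ((if h p.1 = H.fst ∧ h p.2 = H.snd then (1 : ℝ) else 0) *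
          densityFun π G (fun p => adjFun H.graph (h p.1, h p.2)) p) ∂(π.prod π) := by
        refine integral_congr_ae ?_
        filter_upwards [coeFn_velocity R W hW] with p hp
        rw [hp, Finset.mul_sum]
        exact Finset.sum_congr rfl fun G _ => mul_left_comm _ _ _
    _ = ∑ G : RootedGraph k, R.coeff G * ∑ φ : Fin k → Fin k, mapWeight G H φ *
          ∏ i, π.real (h ⁻¹' {φ i}) := by
        rw [integral_finsetSum _ fun G _ => (hI G).1.const_mul _]
        refine Finset.sum_congr rfl fun G _ => ?_
        rw [integral_const_mul, (hI G).2]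
        rfl
    _ = _ := by
        simp_rw [Finset.mul_sum, Finset.sum_mul]
        rw [Finset.sum_comm]
        simp_rw [mul_assoc]

/-- The velocities at graphons determine the orbit coefficients. -/
lemma orbitCoeff_eq_of_velocity_eq (hπ : IsAtomless π) {R₁ R₂ : Rule k}
    (hR : ∀ W : kernelSpace π, IsGraphon W → velocity R₁ W = velocity R₂ W) (J : RootedClass k) :
    R₁.orbitCoeff J = R₂.orbitCoeff J := by
  induction J using Quotient.inductionOn with | _ H
  -- The label set is nonempty because `H` has a root, so `k = 0` needs no separate treatment.
  have hne : Nonempty (Fin k) := ⟨H.fst⟩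
  let w : (Fin k → Fin k) → ℝ := fun φ => ∑ G : RootedGraph k, R₁.coeff G * mapWeight G H φ
    - ∑ G : RootedGraph k, R₂.coeff G * mapWeight G H φ
  have hw : ∀ α : Fin k → ℝ, (∀ i, 0 < α i) → ∑ φ, w φ * ∏ i, α (φ i) = 0 := by
    intro α hα
    -- Part masses must sum to 1, so `α` is normalised by `s`. The polynomial is homogeneous of
    -- degree `k`, which only costs a nonzero factor `s ^ k`.
    set s : ℝ := ∑ i, α i with hs
    have hs0 : 0 < s := Finset.sum_pos (fun i _ => hα i) Finset.univ_nonempty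
    have hsum : ∑ i, ENNReal.ofReal (α i / s) = 1 := by
      rw [← ENNReal.ofReal_sum_of_nonneg fun i _ => (div_pos (hα i) hs0).le, ← Finset.sum_div,
        div_self hs0.ne', ENNReal.ofReal_one]
    obtain ⟨h, hh, hα'⟩ := hπ.exists_measurable_label _ hsum
    have hreal : ∀ i, π.real (h ⁻¹' {i}) = α i / s := fun i => by
      rw [measureReal_def, hα', ENNReal.toReal_ofReal (div_pos (hα i) hs0).le]
    obtain ⟨W, hWg, hW⟩ := exists_step_graphon (π := π) H.graph hh
    have h1 := integral_indicator_mul_velocity R₁ H hh hW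
    rw [hR W hWg, integral_indicator_mul_velocity R₂ H hh hW] at h1
    simp_rw [hreal, Finset.prod_div_distrib, Finset.prod_const] at h1
    have h2 : (∑ φ, w φ * ∏ i, α (φ i)) / s ^ (Finset.univ : Finset (Fin k)).card = 0 := by
      simp_rw [w, sub_mul, Finset.sum_sub_distrib, sub_div, Finset.sum_div, mul_div_assoc]
      exact sub_eq_zero.2 h1.symm
    exact (div_eq_zero_iff.1 h2).resolve_right (pow_pos hs0 _).ne'
  have hperm := sum_perm_eq_zero_of_forall_pos hw
  -- Summed over permutations, the weights of each `G` count its isomorphisms to `H`, so only the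
  -- class of `H` survives. Its multiplier is nonzero because the identity is an automorphism.
  have key : ∀ R : Rule k, ∑ φ : Equiv.Perm (Fin k), ∑ G : RootedGraph k,
      R.coeff G * mapWeight G H φ = H.isoCount H * R.orbitCoeff ⟦H⟧ := by
    intro R
    rw [Finset.sum_comm, ← sum_coeff_mul_isoCount]
    refine Finset.sum_congr rfl fun G _ => ?_
    rw [← Finset.mul_sum, sum_perm_mapWeight]
  simp only [w, Finset.sum_sub_distrib] at hperm
  rw [key, key, ← mul_sub] at hperm
  exact sub_eq_zero.1 ((mul_eq_zero.1 hperm).resolve_left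
    (Nat.cast_ne_zero.2 H.isoCount_self_ne_zero))

end FlipProcess

theorem mainTheorem1 {Ω : Type*} [MeasurableSpace Ω] (π : Measure Ω) [IsProbabilityMeasure π]
    (hπ : FlipProcess.IsAtomless π) (k : ℕ) (R₁ R₂ : FlipProcess.Rule k) :
    List.TFAE [
      ∀ J : FlipProcess.RootedClass k, R₁.orbitCoeff J = R₂.orbitCoeff J,
      ∀ W : FlipProcess.kernelSpace π, FlipProcess.IsGraphon W →
        FlipProcess.velocity R₁ W = FlipProcess.velocity R₂ W,
      ∀ W : FlipProcess.kernelSpace π, FlipProcess.velocity R₁ W = FlipProcess.velocity R₂ W,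
      FlipProcess.SameTrajectories π R₁ R₂] := by
  tfae_have 1 → 3 := FlipProcess.velocity_eq_of_orbitCoeff_eq
  tfae_have 3 → 2 := fun h W _ => h W
  tfae_have 2 → 1 := FlipProcess.orbitCoeff_eq_of_velocity_eq hπ
  tfae_have 3 → 4 := FlipProcess.sameTrajectories_of_velocity_eq
  tfae_have 4 → 3 := FlipProcess.velocity_eq_of_sameTrajectories
  tfae_finish
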